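/- Let $K$ be an algebraically closed field of characteristic zero, $n,d\ge 1$, $R=K[x_0,\dots,x_n]$, and let $Q=K[X_0,\dots,X_n]$ act on $R$ by $X_i=\partial/\partial x_i$. For an ideal $I\subset Q$ put $I^{-1}=\{f\in R: \alpha(f)=0 \text{ for all }\alpha\in I\}$ and let $(I^{-1})_d$ be its space of forms of degree $d$. Let $\varphi_d=(F_1:\dots:F_h)\colon\mathbb P^n\dashrightarrow\mathbb P^{h-1}$ be the rational map given by a basis of $(I^{-1})_d$, and let $X_d$ be the Zariski closure of its image. The $s$-th osculating space of $X_d$ at $\varphi_d(P)$ is the projectivization of the span of all partial derivatives of $(F_1,\dots,F_h)$ of order $\le s$ at $P$; $X_d$ satisfies a Laplace equation of order $s$ if at a general point of $X_d$ this space has dimension less than $\binom{n+s}{s}-1$. Let $\Delta_n=\operatorname{conv}(e_0,\dots,e_n)\subset\mathbb R^{n+1}$ and let $A_I\subset d\Delta_n\cap\mathbb Z^{n+1}$ be the set of exponents of the monomials lying in $(I^{-1})_d$. A hypersurface of degree $s$ is the zero locus of a nonzero form of degree $s$ in $n+1$ variables over $K$. A Togliatti system (of degree $d$) is an Artinian ideal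 of $Q$ (i.e. one with Artinian quotient) generated by at most $\binom{n+d-1}{n-1}$ forms of degree $d$ for which $X_d$ satisfies a Laplace equation of order $d-1$; it is monomial if it can be generated by monomials; a monomial Togliatti system is minimal if no proper subset of its set of monomial generators of degree $d$ generates a monomial Togliatti system. Let $I\subset Q$ be an Artinian ideal generated by $r\le\binom{n+d-1}{n-1}$ monomials of degree $d$. (a) For every $s\in\{1,\dots,d-1\}$, $X_d$ satisfies a Laplace equation of order $s$ if and only if there is a hypersurface of degree $s$ containing $A_I$. In particular, $s$ is the least integer in $\{1,\dots,d-1\}$ such that $X_d$ satisfies a Laplace equation of order $s$ if and only if $s$ is the least integer in $\{1,\dots,d-1\}$ such that there is a hypersurface of degree $s$ containing $A_I$. (b) The following are equivalent: (i) $I$ is a minimal (monomial) Togliatti system; (ii) some hypersurface of degree $s$ with $s\in\{1,\dots,d-1\}$ contains $A_I$, and no hypersurface of degree in $\{1,\dots,d-1\}$ that contains $A_I$ contains a lattice point of $d\Delta_n\setminus A_I$, except possibly some of the vertices of $d\Delta_n$; (iii) some hypersurface of degree $d-1$ contains $A_I$, and no hypersurface of degree $d-1$ that contains $A_I$ contains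 a lattice point of $d\Delta_n\setminus A_I$, except possibly some of the vertices of $d\Delta_n$. -/

import Mathlib

open MvPolynomial

namespace Togliatti

/-- The polynomial ring in the `n + 1` variables indexed by `0, …, n`. It serves both as
`R = K[x₀, …, xₙ]` and as the ring `Q = K[X₀, …, Xₙ]` of differential operators. -/
abbrev Ring (n : ℕ) (K : Type*) [Field K] := MvPolynomial (Fin (n + 1)) K

/-- Exponents of monomials in `n + 1` variables, i.e. points of `ℤ^(n+1)` with nonnegative
coordinates. -/
abbrev Exponent (n : ℕ) := Fin (n + 1) →₀ ℕ

section Apolarity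

variable {n : ℕ} {K : Type*} [Field K]

/-- The differential operator `(∂/∂x₀)^m₀ ∘ ⋯ ∘ (∂/∂xₙ)^mₙ` on `R`. -/
noncomputable def partialDeriv (m : Exponent n) : Ring n K →ₗ[K] Ring n K :=
  (List.ofFn fun i : Fin (n + 1) =>
    ((pderiv i : Derivation K (Ring n K) (Ring n K)).toLinearMap ^ m i :
      Module.End K (Ring n K))).prod

/-- The apolarity action `f ↦ α(f)` of `α ∈ Q` on `R`, given by `X_i = ∂/∂x_i`. -/
noncomputable def apolar (α : Ring n K) : Ring n K →ₗ[K] Ring n K :=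
  ∑ m ∈ α.support, α.coeff m • partialDeriv m

/-- Macaulay's inverse system `I⁻¹ = {f ∈ R | α(f) = 0 for all α ∈ I}`, as a `K`-subspace of `R`. -/
noncomputable def inverseSystem (I : Ideal (Ring n K)) : Submodule K (Ring n K) :=
  ⨅ α ∈ I, LinearMap.ker (apolar α)

/-- The graded piece `(I⁻¹)_d`. -/
noncomputable def inverseSystemDegree (I : Ideal (Ring n K)) (d : ℕ) : Submodule K (Ring n K) :=
  inverseSystem I ⊓ homogeneousSubmodule (Fin (n + 1)) K d

/-- The lattice points of the dilated standard simplex `d Δₙ ⊂ ℝ^(n+1)`. -/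
def simplexPoints (n d : ℕ) : Set (Exponent n) := {a | a.degree = d}

/-- The vertices `d e₀, …, d eₙ` of `d Δₙ`. -/
def simplexVertices (n d : ℕ) : Set (Exponent n) := {a | ∃ i, a = Finsupp.single i d}

/-- The set `A_I` of exponents of the monomials in `(I⁻¹)_d`. -/
def latticeSet (I : Ideal (Ring n K)) (d : ℕ) : Set (Exponent n) :=
  {a | (monomial a (1 : K)) ∈ inverseSystemDegree I d}

end Apolarity

section Osculation

variable {n : ℕ} {K : Type*} [Field K] (W : Submodule K (Ring n K))

/-- The map `K^(n+1) → W*`, `P ↦ (F ↦ F(P))`, attached to a linear system `W` of forms. In the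
coordinates of `W*` given by a basis `F₁, …, F_h` of `W` it is `P ↦ (F₁(P), …, F_h(P))`, so it
induces the rational map `φ_W : ℙⁿ ⇢ ℙ(W*) = ℙ^(h-1)`. -/
noncomputable def coneMap (P : Fin (n + 1) → K) : Module.Dual K W :=
  (aeval P : Ring n K →ₐ[K] K).toLinearMap ∘ₗ W.subtype

/-- The value at a vector `v` of `W*` of a polynomial function on `W*`, written as a polynomial in
the linear coordinates `v ↦ v F` for `F ∈ W`. -/
noncomputable def evalDual (v : Module.Dual K W) (p : MvPolynomial W K) : K :=
  eval (fun F : W => v F) p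

/-- The variety `X ⊂ ℙ(W*)`: the Zariski closure of the image of `φ_W`, i.e. the common zeros of
all homogeneous polynomials that vanish on that image. -/
def imageVariety : Set (Projectivization K (Module.Dual K W)) :=
  {x | ∀ (p : MvPolynomial W K) (e : ℕ), p.IsHomogeneous e →
    (∀ P : Fin (n + 1) → K, coneMap W P ≠ 0 → evalDual W (coneMap W P) p = 0) →
      evalDual W x.rep p = 0}

/-- The affine cone in `W*` over the `s`-th osculating space of `X` at `φ_W(P)`: the span of all
partial derivatives of order at most `s` of the parametrization `φ_W = (F₁ : ⋯ : F_h)` at `P`.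
The projective dimension of the osculating space is the dimension of this vector space minus one. -/
noncomputable def osculatingSpace (s : ℕ) (P : Fin (n + 1) → K) :
    Submodule K (Module.Dual K W) :=
  Submodule.span K {v | ∃ m : Exponent n, m.degree ≤ s ∧
    v = (aeval P : Ring n K →ₐ[K] K).toLinearMap ∘ₗ partialDeriv m ∘ₗ W.subtype}

/-- `X` satisfies (at least) one Laplace equation of order `s`: at a general point `x = φ_W(P)`
of `X` the `s`-th osculating space has (projective) dimension smaller than `C(n+s, s) - 1`.
A general point is one where some fixed homogeneous polynomial `g` that does not vanish
identically on `X` is nonzero, i.e. a point of some nonempty Zariski open subset of `X`. -/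
def SatisfiesLaplace (s : ℕ) : Prop :=
  ∃ (g : MvPolynomial W K) (e : ℕ), g.IsHomogeneous e ∧
    (∃ x ∈ imageVariety W, evalDual W x.rep g ≠ 0) ∧
    ∀ x ∈ imageVariety W, evalDual W x.rep g ≠ 0 →
      ∀ (P : Fin (n + 1) → K) (hP : coneMap W P ≠ 0),
        Projectivization.mk K (coneMap W P) hP = x →
          Module.finrank K (osculatingSpace W s P) < (n + s).choose s

end Osculation

section TogliattiSystems

variable {n : ℕ} {K : Type*} [Field K]

/-- The ideal of `Q` generated by the monomials with exponents in `G`. -/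
noncomputable def monomialIdeal (K : Type*) [Field K] (G : Set (Exponent n)) : Ideal (Ring n K) :=
  Ideal.span ((fun m => monomial m (1 : K)) '' G)

/-- `I` is an Artinian ideal generated by `r ≤ C(n+d-1, n-1)` forms of degree `d` and the variety
`X_d` satisfies at least one Laplace equation of order `d - 1`. -/
structure IsTogliattiSystem (d : ℕ) (I : Ideal (Ring n K)) : Prop where
  artinian : IsArtinianRing (Ring n K ⧸ I)
  generators : ∃ G : Finset (Ring n K), (∀ F ∈ G, F.IsHomogeneous d) ∧
    G.card ≤ (n + d - 1).choose (n - 1) ∧ Ideal.span (G : Set (Ring n K)) = I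
  laplace : SatisfiesLaplace (inverseSystemDegree I d) (d - 1)

/-- A Togliatti system that can be generated by monomials. -/
structure IsMonomialTogliattiSystem (d : ℕ) (I : Ideal (Ring n K)) : Prop
    extends IsTogliattiSystem d I where
  monomial : ∃ G : Set (Exponent n), monomialIdeal K G = I

/-- A monomial Togliatti system such that no proper subset of its set of (degree `d`) monomial
generators defines a monomial Togliatti system. -/
structure IsMinimalTogliattiSystem (d : ℕ) (I : Ideal (Ring n K)) : Prop
    extends IsMonomialTogliattiSystem d I where
  minimal : ∀ G : Set (Exponent n), G ⊆ simplexPoints n d → monomialIdeal K G = I →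
    ∀ G' : Set (Exponent n), G' ⊂ G → ¬ IsMonomialTogliattiSystem d (monomialIdeal K G')

/-- `F` defines a hypersurface of degree `s` in `ℙⁿ`: it is a nonzero form of degree `s`. -/
def IsHypersurface (s : ℕ) (F : Ring n K) : Prop := F ≠ 0 ∧ F.IsHomogeneous s

/-- The hypersurface `F = 0` contains the lattice point `a`. -/
def ContainsPoint (F : Ring n K) (a : Exponent n) : Prop := eval (fun i => (a i : K)) F = 0

/-- The hypersurface `F = 0` contains `A_I`. -/
def ContainsLatticeSet (F : Ring n K) (I : Ideal (Ring n K)) (d : ℕ) : Prop :=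
  ∀ a ∈ latticeSet I d, ContainsPoint F a

/-- The hypersurface `F = 0` contains no lattice point of `d Δₙ` outside `A_I`, except possibly
some of the vertices of `d Δₙ`. -/
def MeetsComplementOnlyInVertices (F : Ring n K) (I : Ideal (Ring n K)) (d : ℕ) : Prop :=
  ∀ a ∈ simplexPoints n d \ latticeSet I d, ContainsPoint F a → a ∈ simplexVertices n d

end TogliattiSystems

end Togliatti

/-! Since $I$ is generated by monomials of degree $d$, the space $(I^{-1})_d$ is spanned by the
$x^a$ with $a\in A=A_I$, the lattice points of $d\Delta_n$ that are not generators. At a point $P$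
with all $P^a\ne 0$, the value of $\partial^m x^a$ divided by $P^a$ is $P^{-m}\prod_i
a_i(a_i-1)\cdots(a_i-m_i+1)$. Rescaling therefore identifies the $s$-th osculating space with the
functions on $A$ spanned by falling factorials of order at most $s$ (`finrank_osculatingSpace`).
These are the polynomial functions of degree at most $s$, and since $\sum a_i=d\neq 0$ on $A$ they
can be homogenised to forms of degree exactly $s$ (`fallingFactorialValues_eq_formValues`). Such
forms make up a space of dimension $\binom{n+s}{s}$, so the dimension drops exactly when a nonzero
one vanishes on $A$. This is (a).

For (b), the ideal is Artinian exactly when all vertices of $d\Delta_n$ are generators. Dropping a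
generator adds a point to $A$, so minimality fails exactly when some hypersurface of degree $d-1$
through $A$ meets a generator that is not a vertex (`isMinimalTogliattiSystem_iff`). Multiplying by
a power of $x_0$ carries lower degrees to degree $d-1$. -/

namespace Togliatti

/-! ### Derivatives of monomials and falling factorials. -/

section Derivatives

variable {n : ℕ} {K : Type*} [Field K]

theorem pderiv_pow_monomial (i : Fin (n + 1)) (k : ℕ) (b : Exponent n) (c : K) :
    ((pderiv i : Derivation K (Ring n K) (Ring n K)).toLinearMap ^ k : Module.End K (Ring n K))
        (monomial b c) =
      monomial (b - Finsupp.single i k) (c * ((b i).descFactorial k : K)) := by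
  induction k with
  | zero => simp
  | succ k ih =>
    rw [pow_succ', Module.End.mul_apply, ih, Derivation.coeFn_coe, pderiv_monomial, tsub_tsub,
      ← Finsupp.single_add, Finsupp.tsub_apply, Finsupp.single_eq_same, Nat.descFactorial_succ]
    push_cast
    congr 1
    ring

/-- As the variables in the list are distinct, each derivative still sees the original exponent of
its variable. -/
theorem list_pderiv_pow_monomial (m a : Exponent n) (c : K) (l : List (Fin (n + 1)))
    (hl : l.Nodup) :
    (l.map fun i => ((pderiv i : Derivation K (Ring n K) (Ring n K)).toLinearMap ^ m i :
        Module.End K (Ring n K))).prod (monomial a c) =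
      monomial (a - (l.map fun i => Finsupp.single i (m i)).sum)
        (c * (l.map fun i => ((a i).descFactorial (m i) : K)).prod) := by
  induction l with
  | nil => simp
  | cons i l ih =>
    rw [List.nodup_cons] at hl
    have h0 : (l.map fun j => Finsupp.single j (m j)).sum i = 0 := by
      have := hl.1
      clear ih hl
      induction l with
      | nil => simp
      | cons j l ih =>
        rw [List.mem_cons, not_or] at this
        simp [ih this.2, Finsupp.single_eq_of_ne this.1]
    rw [List.map_cons, List.prod_cons, Module.End.mul_apply, ih hl.2, pderiv_pow_monomial,
      Finsupp.tsub_apply, h0, Nat.sub_zero, tsub_tsub, List.map_cons, List.sum_cons, List.map_cons,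
      List.prod_cons, add_comm (Finsupp.single i (m i))]
    congr 1
    ring

/-- The product of falling factorials `∏ᵢ aᵢ (aᵢ - 1) ⋯ (aᵢ - mᵢ + 1)` as an element of `K`. -/
def fallingFactorial (K : Type*) [Field K] (m a : Exponent n) : K :=
  ∏ i, ((a i).descFactorial (m i) : K)

theorem partialDeriv_monomial (m a : Exponent n) (c : K) :
    partialDeriv m (monomial a c) = monomial (a - m) (c * fallingFactorial K m a) := by
  have hm : (List.map (fun i => Finsupp.single i (m i)) (List.finRange (n + 1))).sum = m := by
    rw [← List.ofFn_eq_map, List.sum_ofFn]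
    exact Finsupp.univ_sum_single m
  rw [partialDeriv, List.ofFn_eq_map, list_pderiv_pow_monomial _ _ _ _ (List.nodup_finRange _),
    hm, ← List.ofFn_eq_map (f := fun i => ((a i).descFactorial (m i) : K)), List.prod_ofFn]
  rfl

theorem fallingFactorial_eq_zero {m a : Exponent n} (h : ¬ m ≤ a) :
    fallingFactorial K m a = 0 := by
  rw [Finsupp.le_def, not_forall] at h
  obtain ⟨i, hi⟩ := h
  refine Finset.prod_eq_zero (Finset.mem_univ i) ?_
  rw [Nat.descFactorial_of_lt (not_le.1 hi), Nat.cast_zero]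

theorem fallingFactorial_self_ne_zero [CharZero K] (m : Exponent n) :
    fallingFactorial K m m ≠ 0 := by
  refine Finset.prod_ne_zero_iff.2 fun i _ => ?_
  rw [Nat.descFactorial_self]
  exact_mod_cast Nat.factorial_ne_zero _

theorem eq_of_le_of_degree_eq {m a : Exponent n} (h : m ≤ a) (hd : m.degree = a.degree) :
    m = a := by
  obtain ⟨b, rfl⟩ := exists_add_of_le h
  have : b.degree = 0 := by simpa using hd
  simp [(Finsupp.degree_eq_zero_iff b).1 this]

theorem degree_eq_of_mem_support {d : ℕ} {f : Ring n K} (hf : f.IsHomogeneous d) {a : Exponent n}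
    (ha : a ∈ f.support) : a.degree = d := by
  by_contra h
  exact mem_support_iff.1 ha (hf.coeff_eq_zero h)

theorem partialDeriv_of_isHomogeneous {d : ℕ} {m : Exponent n} (hm : m.degree = d) {f : Ring n K}
    (hf : f.IsHomogeneous d) :
    partialDeriv m f = C (f.coeff m * fallingFactorial K m m) := by
  conv_lhs => rw [f.as_sum, map_sum]
  simp only [partialDeriv_monomial]
  rw [Finset.sum_eq_single m]
  · rw [tsub_self, C_apply]
  · intro b hb hbm
    rw [fallingFactorial_eq_zero, mul_zero, monomial_zero]
    intro hle
    have hbd := degree_eq_of_mem_support hf hb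
    exact hbm (eq_of_le_of_degree_eq hle (hm.trans hbd.symm)).symm
  · intro h
    rw [notMem_support_iff.1 h]
    simp

theorem apolar_monomial_one (m : Exponent n) (f : Ring n K) :
    apolar (monomial m (1 : K)) f = partialDeriv m f := by
  simp [apolar]

end Derivatives

/-! ### Inverse systems of monomial ideals. -/

section InverseSystem

variable {n : ℕ} {K : Type*} [Field K]

theorem mem_inverseSystem {I : Ideal (Ring n K)} {f : Ring n K} :
    f ∈ inverseSystem I ↔ ∀ α ∈ I, apolar α f = 0 := by
  simp [inverseSystem]

theorem mem_monomialIdeal {G : Set (Exponent n)} {x : Ring n K} :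
    x ∈ monomialIdeal K G ↔ ∀ a ∈ x.support, ∃ m ∈ G, m ≤ a :=
  mem_ideal_span_monomial_image

theorem monomial_mem_monomialIdeal_iff {d : ℕ} {G : Set (Exponent n)}
    (hG : G ⊆ simplexPoints n d) {a : Exponent n} (ha : a.degree = d) :
    monomial a (1 : K) ∈ monomialIdeal K G ↔ a ∈ G := by
  rw [mem_monomialIdeal]
  constructor
  · intro h
    obtain ⟨m, hm, hma⟩ := h a (by simp)
    rwa [← eq_of_le_of_degree_eq hma ((hG hm).trans ha.symm)]
  · intro h b hb
    exact ⟨a, h, (Finset.mem_singleton.1 (support_monomial_subset hb)).ge⟩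

theorem monomialIdeal_injOn {d : ℕ} {G G' : Set (Exponent n)} (hG : G ⊆ simplexPoints n d)
    (hG' : G' ⊆ simplexPoints n d) (h : monomialIdeal K G = monomialIdeal K G') : G = G' := by
  ext a
  constructor
  · intro ha
    rw [← monomial_mem_monomialIdeal_iff (K := K) hG' (hG ha), ← h]
    exact (monomial_mem_monomialIdeal_iff hG (hG ha)).2 ha
  · intro ha
    rw [← monomial_mem_monomialIdeal_iff (K := K) hG (hG' ha), h]
    exact (monomial_mem_monomialIdeal_iff hG' (hG' ha)).2 ha

/-- The degree `d` part of the inverse system of an ideal generated by monomials of degree `d` is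
spanned by the remaining monomials of degree `d`. -/
theorem inverseSystemDegree_monomialIdeal [CharZero K] {d : ℕ} {G : Set (Exponent n)}
    (hG : G ⊆ simplexPoints n d) :
    inverseSystemDegree (monomialIdeal K G) d = restrictSupport K (simplexPoints n d \ G) := by
  apply le_antisymm
  · rintro f ⟨hf, hfd⟩
    rw [SetLike.mem_coe, mem_homogeneousSubmodule] at hfd
    rw [mem_restrictSupport_iff]
    intro a ha
    have had : a.degree = d := degree_eq_of_mem_support hfd ha
    refine ⟨had, fun haG => ?_⟩
    -- Applying the generator with exponent $a$ to $f$ isolates the coefficient of $x^a$, up to a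
    -- product of factorials that is nonzero in characteristic zero.
    have h := mem_inverseSystem.1 hf _ ((monomial_mem_monomialIdeal_iff hG had).2 haG)
    rw [apolar_monomial_one, partialDeriv_of_isHomogeneous had hfd, C_eq_zero] at h
    exact (mem_support_iff.1 ha) ((mul_eq_zero.1 h).resolve_right (fallingFactorial_self_ne_zero a))
  · rw [restrictSupport_eq_span, Submodule.span_le]
    rintro _ ⟨a, ⟨had, haG⟩, rfl⟩
    refine ⟨mem_inverseSystem.2 fun α hα => ?_, ?_⟩
    · rw [apolar, LinearMap.sum_apply]
      refine Finset.sum_eq_zero fun m hm => ?_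
      rw [LinearMap.smul_apply, partialDeriv_monomial, fallingFactorial_eq_zero]
      · simp
      · intro hma
        obtain ⟨b, hb, hbm⟩ := mem_monomialIdeal.1 hα m hm
        exact haG (eq_of_le_of_degree_eq (hbm.trans hma) ((hG hb).trans had.symm) ▸ hb)
    · exact isHomogeneous_monomial _ had

theorem latticeSet_monomialIdeal [CharZero K] {d : ℕ} {G : Set (Exponent n)}
    (hG : G ⊆ simplexPoints n d) :
    latticeSet (monomialIdeal K G) d = simplexPoints n d \ G := by
  ext a
  rw [latticeSet, Set.mem_ofPred_eq, inverseSystemDegree_monomialIdeal hG,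
    monomial_mem_restrictSupport]
  simp

end InverseSystem

end Togliatti

namespace Togliatti

/-! ### Forms and falling factorials as functions on lattice points. -/

section Evaluation

variable {n : ℕ} {K : Type*} [Field K]

theorem finite_simplexPoints (n d : ℕ) : (simplexPoints n d).Finite :=
  (Finsupp.finite_of_degree_le d).subset fun _ ha => le_of_eq ha

theorem ncard_simplexPoints (n d : ℕ) : (simplexPoints n d).ncard = (n + d).choose d := by
  have : simplexPoints n d = (Finset.finsuppAntidiag (Finset.univ : Finset (Fin (n + 1))) d :
      Set (Exponent n)) := by
    ext a
    simp [simplexPoints, Finsupp.degree_eq_sum, Finset.mem_finsuppAntidiag]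
  rw [this, Set.ncard_coe_finset, Finset.card_finsuppAntidiag_nat_eq_choose]
  simp [add_right_comm]

theorem homogeneousSubmodule_eq_restrictSupport (s : ℕ) :
    homogeneousSubmodule (Fin (n + 1)) K s = restrictSupport K (simplexPoints n s) :=
  homogeneousSubmodule_eq_finsupp_supported _ _ s

instance (s : ℕ) : FiniteDimensional K (homogeneousSubmodule (Fin (n + 1)) K s) := by
  rw [homogeneousSubmodule_eq_restrictSupport]
  have := (finite_simplexPoints n s).to_subtype
  exact Module.Finite.of_basis (basisRestrictSupport K (simplexPoints n s))

theorem finrank_homogeneousSubmodule (s : ℕ) :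
    Module.finrank K (homogeneousSubmodule (Fin (n + 1)) K s) = (n + s).choose s := by
  rw [homogeneousSubmodule_eq_restrictSupport, Module.finrank_eq_nat_card_basis
    (basisRestrictSupport K (simplexPoints n s)), Nat.card_coe_set_eq, ncard_simplexPoints]

/-- The restriction of a polynomial to a set of lattice points. -/
noncomputable def evalLattice (A : Set (Exponent n)) : Ring n K →ₐ[K] (A → K) :=
  AlgHom.pi fun a => aeval fun i => ((a : Exponent n) i : K)

theorem evalLattice_apply (A : Set (Exponent n)) (F : Ring n K) (a : A) :
    evalLattice A F a = eval (fun i => ((a : Exponent n) i : K)) F := by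
  simp [evalLattice, aeval_eq_eval]

/-- The functions on `A` that are given by forms of degree `s`. -/
noncomputable def formValues (K : Type*) [Field K] (A : Set (Exponent n)) (s : ℕ) :
    Submodule K (A → K) :=
  (homogeneousSubmodule (Fin (n + 1)) K s).map (evalLattice A).toLinearMap

/-- Rank–nullity for restricting forms of degree $s$ to $A$: the nonzero kernel elements are the
hypersurfaces through $A$. -/
theorem finrank_formValues_lt_iff (A : Set (Exponent n)) (s : ℕ) :
    Module.finrank K (formValues K A s) < (n + s).choose s ↔
      ∃ F : Ring n K, IsHypersurface s F ∧ ∀ a ∈ A, ContainsPoint F a := by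
  set T : homogeneousSubmodule (Fin (n + 1)) K s →ₗ[K] (A → K) :=
    (evalLattice A).toLinearMap ∘ₗ (homogeneousSubmodule (Fin (n + 1)) K s).subtype with hT
  have hr : formValues K A s = LinearMap.range T := by
    rw [hT, LinearMap.range_comp, Submodule.range_subtype, formValues]
  have hk := LinearMap.finrank_range_add_finrank_ker T
  rw [finrank_homogeneousSubmodule] at hk
  rw [hr, ← hk, lt_add_iff_pos_right,
    Module.finrank_pos_iff_exists_ne_zero (R := K) (M := LinearMap.ker T)]
  constructor
  · rintro ⟨⟨⟨F, hF⟩, hFT⟩, h0⟩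
    refine ⟨F, ⟨fun h => h0 ?_, hF⟩, fun a ha => ?_⟩
    · simp only [h]
      rfl
    · have := congrFun (LinearMap.mem_ker.1 hFT) ⟨a, ha⟩
      rw [ContainsPoint]
      rwa [← evalLattice_apply A F ⟨a, ha⟩]
  · rintro ⟨F, ⟨h0, hF⟩, hA⟩
    refine ⟨⟨⟨F, hF⟩, LinearMap.mem_ker.2 (funext fun a => ?_)⟩, fun h => h0 ?_⟩
    · exact (evalLattice_apply A F a).trans (hA a a.2)
    · exact congrArg (fun x => ((x : homogeneousSubmodule (Fin (n + 1)) K s) : Ring n K))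
        (congrArg Subtype.val h)

theorem fallingFactorial_zero (a : Exponent n) : fallingFactorial K 0 a = 1 := by
  simp [fallingFactorial]

theorem fallingFactorial_add_single (m a : Exponent n) (i : Fin (n + 1)) :
    fallingFactorial K (m + Finsupp.single i 1) a =
      ((a i : K) - m i) * fallingFactorial K m a := by
  have h (k l : ℕ) : ((k.descFactorial (l + 1) : ℕ) : K) = ((k : K) - l) * k.descFactorial l := by
    rw [Nat.descFactorial_succ]
    -- The subtraction in ℕ is truncated; when it differs from the one in $K$, the falling factorial
    -- beside it is zero.
    rcases le_or_gt l k with hlk | hlk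
    · push_cast [hlk]
      rfl
    · simp [Nat.descFactorial_of_lt hlk]
  rw [fallingFactorial, fallingFactorial, ← Finset.mul_prod_erase _ _ (Finset.mem_univ i),
    ← Finset.mul_prod_erase (Finset.univ : Finset (Fin (n + 1)))
      (fun j => ((a j).descFactorial (m j) : K)) (Finset.mem_univ i), ← mul_assoc]
  congr 1
  · rw [Finsupp.add_apply, Finsupp.single_eq_same, h]
  · refine Finset.prod_congr rfl fun j hj => ?_
    rw [Finsupp.add_apply, Finsupp.single_eq_of_ne (Finset.ne_of_mem_erase hj), add_zero]

theorem exponent_induction {p : Exponent n → Prop} (zero : p 0)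
    (add_single : ∀ m i, p m → p (m + Finsupp.single i 1)) (m : Exponent n) : p m := by
  induction h : m.degree generalizing m with
  | zero => rwa [(Finsupp.degree_eq_zero_iff m).1 h]
  | succ k ih =>
    have hm : m ≠ 0 := by
      rintro rfl
      simp at h
    obtain ⟨i, hi⟩ := Finsupp.ne_iff.1 hm
    have hle : Finsupp.single i 1 ≤ m :=
      Finsupp.single_le_iff.2 (Nat.one_le_iff_ne_zero.2 hi)
    rw [← tsub_add_cancel_of_le hle] at h ⊢
    rw [map_add, Finsupp.degree_single] at h
    exact add_single _ i (ih _ (Nat.succ_injective h))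

/-- The functions on `A` spanned by falling factorials of order at most `s`. -/
noncomputable def fallingFactorialValues (K : Type*) [Field K] (A : Set (Exponent n)) (s : ℕ) :
    Submodule K (A → K) :=
  Submodule.span K ((fun (m : Exponent n) (a : A) => fallingFactorial K m a) ''
    {m | m.degree ≤ s})

/-- Each new factor $a_i-m_i$ agrees on $A$ with the linear form $X_i-\frac{m_i}{d}\sum_j X_j$,
because $\sum_j a_j=d$ there. -/
theorem fallingFactorial_mem_formValues [CharZero K] {A : Set (Exponent n)} {d : ℕ} (hd : d ≠ 0)
    (hA : A ⊆ simplexPoints n d) (m : Exponent n) :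
    (fun a : A => fallingFactorial K m a) ∈ formValues K A m.degree := by
  induction m using exponent_induction with
  | zero =>
    refine ⟨1, isHomogeneous_one _ _, ?_⟩
    ext a
    simp [fallingFactorial_zero]
  | add_single m i ih =>
    obtain ⟨F, hF, hFm⟩ := ih
    refine ⟨F * (X i - C ((m i : K) / d) * ∑ j, X j), ?_, ?_⟩
    · rw [map_add, Finsupp.degree_single]
      refine IsHomogeneous.mul hF ((isHomogeneous_X _ _).sub ?_)
      exact (IsHomogeneous.sum _ _ _ fun j _ => isHomogeneous_X _ _).C_mul _
    · ext a
      have ha : ∑ j, ((a : Exponent n) j : K) = d := by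
        rw [← hA a.2, Finsupp.degree_eq_sum]
        push_cast
        rfl
      have hF' := congrFun hFm a
      rw [AlgHom.toLinearMap_apply, evalLattice_apply] at hF' ⊢
      have hd' : (d : K) ≠ 0 := Nat.cast_ne_zero.2 hd
      rw [fallingFactorial_add_single, map_mul, hF', map_sub, map_mul, map_sum, eval_X, eval_C]
      simp only [eval_X]
      rw [ha, div_mul_cancel₀ _ hd', mul_comm]

/-- The linear form $\frac1d\sum_j X_j$ equals $1$ on $A$, so multiplying by it raises the degree
without changing values. -/
theorem formValues_mono [CharZero K] {A : Set (Exponent n)} {d : ℕ} (hd : d ≠ 0)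
    (hA : A ⊆ simplexPoints n d) : Monotone (formValues K A) := by
  refine monotone_nat_of_le_succ fun s => ?_
  rintro _ ⟨F, hF, rfl⟩
  refine ⟨F * (C (d : K)⁻¹ * ∑ j, X j), ?_, ?_⟩
  · exact IsHomogeneous.mul hF
      ((IsHomogeneous.sum _ _ _ fun j _ => isHomogeneous_X _ _).C_mul _)
  · ext a
    have ha : ∑ j, ((a : Exponent n) j : K) = d := by
      rw [← hA a.2, Finsupp.degree_eq_sum]
      push_cast
      rfl
    have hd' : (d : K) ≠ 0 := Nat.cast_ne_zero.2 hd
    rw [AlgHom.toLinearMap_apply, AlgHom.toLinearMap_apply, evalLattice_apply, evalLattice_apply,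
      map_mul, map_mul, map_sum, eval_C]
    simp only [eval_X]
    rw [ha, inv_mul_cancel₀ hd', mul_one]

/-- Writing $(a)_m$ for the falling factorial, $a_i\,(a)_m=(a)_{m+e_i}+m_i\,(a)_m$. This drives the
induction expressing monomials through falling factorials. -/
theorem mul_coord_mem_fallingFactorialValues {A : Set (Exponent n)} {s : ℕ} (i : Fin (n + 1))
    {f : A → K} (hf : f ∈ fallingFactorialValues K A s) :
    (fun a : A => ((a : Exponent n) i : K) * f a) ∈ fallingFactorialValues K A (s + 1) := by
  have h : (fallingFactorialValues K A s).map
      (LinearMap.mulLeft K (fun a : A => ((a : Exponent n) i : K))) ≤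
        fallingFactorialValues K A (s + 1) := by
    rw [fallingFactorialValues, Submodule.map_span, Submodule.span_le]
    rintro _ ⟨_, ⟨m, hm, rfl⟩, rfl⟩
    rw [Set.mem_ofPred_eq] at hm
    have : LinearMap.mulLeft K (fun a : A => ((a : Exponent n) i : K))
        (fun a : A => fallingFactorial K m a) =
        (fun a : A => fallingFactorial K (m + Finsupp.single i 1) a) +
          (m i : K) • fun a : A => fallingFactorial K m a := by
      ext a
      simp only [LinearMap.mulLeft_apply, Pi.mul_apply, Pi.add_apply, Pi.smul_apply, smul_eq_mul,
        fallingFactorial_add_single]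
      ring
    rw [this]
    refine Submodule.add_mem _ (Submodule.subset_span ⟨_, ?_, rfl⟩)
      (Submodule.smul_mem _ _ (Submodule.subset_span ⟨m, ?_, rfl⟩))
    · rw [Set.mem_ofPred_eq, map_add, Finsupp.degree_single]
      lia
    · rw [Set.mem_ofPred_eq]
      lia
  exact h ⟨f, hf, rfl⟩

theorem evalLattice_monomial_mem (A : Set (Exponent n)) (m : Exponent n) :
    evalLattice A (monomial m (1 : K)) ∈ fallingFactorialValues K A m.degree := by
  induction m using exponent_induction with
  | zero =>
    refine Submodule.subset_span ⟨0, by simp, ?_⟩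
    ext a
    simp [fallingFactorial_zero, evalLattice_apply]
  | add_single m i ih =>
    rw [map_add, Finsupp.degree_single]
    convert mul_coord_mem_fallingFactorialValues i ih using 1
    ext a
    rw [evalLattice_apply, evalLattice_apply, mul_comm,
      ← eval_X (f := fun i => ((a : Exponent n) i : K)) i, ← map_mul, X, monomial_mul, mul_one]

theorem fallingFactorialValues_eq_formValues [CharZero K] {A : Set (Exponent n)} {d : ℕ}
    (hd : d ≠ 0) (hA : A ⊆ simplexPoints n d) (s : ℕ) :
    fallingFactorialValues K A s = formValues K A s := by
  apply le_antisymm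
  · rw [fallingFactorialValues, Submodule.span_le]
    rintro _ ⟨m, hm, rfl⟩
    exact formValues_mono hd hA hm (fallingFactorial_mem_formValues hd hA m)
  · rw [formValues, homogeneousSubmodule_eq_restrictSupport, restrictSupport_eq_span,
      Submodule.map_span, Submodule.span_le]
    rintro _ ⟨_, ⟨m, hm, rfl⟩, rfl⟩
    have := evalLattice_monomial_mem (K := K) A m
    rwa [show m.degree = s from hm] at this

end Evaluation
end Togliatti

namespace Togliatti

/-! ### Osculating spaces as spaces of functions on $A$. -/

section Osculation

variable {n : ℕ} {K : Type*} [Field K]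

theorem span_image_smul_of_ne_zero {M ι : Type*} [AddCommGroup M] [Module K M] (S : Set ι)
    (v : ι → M) (c : ι → K) (hc : ∀ i ∈ S, c i ≠ 0) :
    Submodule.span K ((fun i => c i • v i) '' S) = Submodule.span K (v '' S) := by
  apply le_antisymm <;> rw [Submodule.span_le]
  · rintro _ ⟨i, hi, rfl⟩
    exact Submodule.smul_mem _ _ (Submodule.subset_span ⟨i, hi, rfl⟩)
  · rintro _ ⟨i, hi, rfl⟩
    have := Submodule.smul_mem _ (c i)⁻¹
      (Submodule.subset_span (R := K) (s := (fun i => c i • v i) '' S) ⟨i, hi, rfl⟩)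
    rwa [smul_smul, inv_mul_cancel₀ (hc i hi), one_smul] at this

/-- The monomial `x^a`, `a ∈ A`, as an element of the span of such monomials. -/
noncomputable def monomialVec (A : Set (Exponent n)) (a : A) : restrictSupport K A :=
  ⟨monomial a (1 : K), (monomial_mem_restrictSupport K).2 (Or.inl a.2)⟩

/-- The coordinates `v ↦ v(x^a) / P^a` on the dual of the span of the monomials `x^a`, `a ∈ A`. -/
noncomputable def dualCoords (A : Set (Exponent n)) (P : Fin (n + 1) → K) :
    Module.Dual K (restrictSupport K A) →ₗ[K] (A → K) :=
  LinearMap.pi fun a => (∏ i, P i ^ (a : Exponent n) i)⁻¹ •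
    LinearMap.applyₗ (monomialVec A a)

theorem dual_ext {A : Set (Exponent n)} {v w : Module.Dual K (restrictSupport K A)}
    (h : ∀ a : A, v (monomialVec A a) =
      w (monomialVec A a)) : v = w := by
  refine (basisRestrictSupport K A).ext fun a => ?_
  have hb : basisRestrictSupport K A a = monomialVec A a := by
    classical
    rw [Module.Basis.apply_eq_iff]
    ext b
    change coeff b (monomial (a : Exponent n) (1 : K)) = _
    rw [coeff_monomial, Finsupp.single_apply]
    simp only [Subtype.ext_iff]
  rw [hb, h]

theorem dualCoords_injective {A : Set (Exponent n)} {P : Fin (n + 1) → K}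
    (hP : ∀ a ∈ A, ∏ i, P i ^ a i ≠ 0) : Function.Injective (dualCoords A P) := by
  intro v w h
  refine dual_ext fun a => ?_
  have := congrFun h a
  exact mul_left_cancel₀ (inv_ne_zero (hP a a.2)) this

/-- In the coordinates `dualCoords`, the derivative $\partial^m$ at $P$ becomes a nonzero multiple
of the falling factorial function of $m$. The right-hand side does not involve $P$, so the dimension
is the same at all such points. -/
theorem finrank_osculatingSpace {A : Set (Exponent n)} {P : Fin (n + 1) → K}
    (hP : ∀ a ∈ A, ∏ i, P i ^ a i ≠ 0) (s : ℕ) :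
    Module.finrank K (osculatingSpace (restrictSupport K A) s P) =
      Module.finrank K (fallingFactorialValues K A s) := by
  classical
  -- Some $P_i$ may vanish, but then $a_i=0$ on all of $A$. Only $m$ with $m_i=0$ then contribute,
  -- and the value $1$ keeps the scalar $P'^m$ invertible for every $m$.
  set P' : Fin (n + 1) → K := fun i => if P i = 0 then 1 else P i with hP'
  have hP'0 (m : Exponent n) : ∏ i, P' i ^ m i ≠ 0 := by
    refine Finset.prod_ne_zero_iff.2 fun i _ => pow_ne_zero _ ?_
    rw [hP']
    dsimp only
    split_ifs with h
    · exact one_ne_zero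
    · exact h
  have key (m a : Exponent n) (ha : a ∈ A) :
      (∏ i, P i ^ a i)⁻¹ * (fallingFactorial K m a * ∏ i, P i ^ (a - m) i) =
        (∏ i, P' i ^ m i)⁻¹ * fallingFactorial K m a := by
    by_cases hma : m ≤ a
    · have h : ∏ i, P i ^ a i = (∏ i, P i ^ (a - m) i) * ∏ i, P' i ^ m i := by
        rw [← Finset.prod_mul_distrib]
        refine Finset.prod_congr rfl fun i _ => ?_
        have hi := Finset.prod_ne_zero_iff.1 (hP a ha) i (Finset.mem_univ i)
        have hmi := hma i
        by_cases h0 : P i = 0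
        · have hai : a i = 0 := by
            by_contra hai
            exact hi (by rw [h0, zero_pow hai])
          have : m i = 0 := by lia
          simp [hai, this]
        · simp only [hP', h0, if_false, Finsupp.tsub_apply]
          rw [← pow_add, Nat.sub_add_cancel hmi]
      have h1 := hP a ha
      have h2 := hP'0 m
      rw [h] at h1 ⊢
      have h3 := left_ne_zero_of_mul h1
      field_simp
    · rw [fallingFactorial_eq_zero hma]
      simp
  have hmap : (osculatingSpace (restrictSupport K A) s P).map (dualCoords A P) =
      fallingFactorialValues K A s := by
    rw [osculatingSpace, Submodule.map_span, fallingFactorialValues,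
      ← span_image_smul_of_ne_zero _ _ (fun m => (∏ i, P' i ^ m i)⁻¹) fun m _ => inv_ne_zero (hP'0 m)]
    have hset : {v | ∃ m : Exponent n, m.degree ≤ s ∧
        v = (aeval P : Ring n K →ₐ[K] K).toLinearMap ∘ₗ partialDeriv m ∘ₗ
          (restrictSupport K A).subtype} =
        (fun m : Exponent n => (aeval P : Ring n K →ₐ[K] K).toLinearMap ∘ₗ partialDeriv m ∘ₗ
          (restrictSupport K A).subtype) '' {m | m.degree ≤ s} := by
      ext v
      exact ⟨fun ⟨m, hm, h⟩ => ⟨m, hm, h.symm⟩, fun ⟨m, hm, h⟩ => ⟨m, hm, h.symm⟩⟩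
    rw [hset, ← Set.image_comp]
    congr 1
    refine Set.image_congr fun m _ => ?_
    ext a
    have : dualCoords A P ((aeval P : Ring n K →ₐ[K] K).toLinearMap ∘ₗ partialDeriv m ∘ₗ
          (restrictSupport K A).subtype) a =
        (∏ i, P i ^ (a : Exponent n) i)⁻¹ * aeval P (partialDeriv m (monomial a (1 : K))) := rfl
    rw [Function.comp_apply, this, partialDeriv_monomial, aeval_eq_eval, eval_monomial,
      Finsupp.prod_fintype _ _ fun i => pow_zero _, one_mul, key m a a.2]
    rfl
  rw [← hmap]
  exact (Submodule.equivMapOfInjective _ (dualCoords_injective hP) _).finrank_eq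

end Osculation

/-! ### General points and Laplace equations. -/

section GeneralPoint

variable {n : ℕ} {K : Type*} [Field K]

theorem eval_smul_of_isHomogeneous {σ : Type*} {p : MvPolynomial σ K} {e : ℕ}
    (hp : p.IsHomogeneous e) (c : K) (x : σ → K) :
    eval (fun i => c * x i) p = c ^ e * eval x p := by
  rw [eval_eq, eval_eq, Finset.mul_sum]
  refine Finset.sum_congr rfl fun m hm => ?_
  rw [hp.degree_eq_sum_deg_support hm, ← Finset.prod_pow_eq_pow_sum]
  simp only [mul_pow, Finset.prod_mul_distrib]
  ring

theorem evalDual_smul {W : Submodule K (Ring n K)} {p : MvPolynomial W K} {e : ℕ}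
    (hp : p.IsHomogeneous e) (c : K) (v : Module.Dual K W) :
    evalDual W (c • v) p = c ^ e * evalDual W v p :=
  eval_smul_of_isHomogeneous hp c _

theorem evalDual_rep_mk {W : Submodule K (Ring n K)} {p : MvPolynomial W K} {e : ℕ}
    (hp : p.IsHomogeneous e) (v : Module.Dual K W) (hv : v ≠ 0) :
    evalDual W (Projectivization.mk K v hv).rep p = 0 ↔ evalDual W v p = 0 := by
  obtain ⟨c, hc⟩ := Projectivization.exists_smul_eq_mk_rep K v hv
  rw [← hc, Units.smul_def, evalDual_smul hp, mul_eq_zero,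
    or_iff_right (pow_ne_zero _ c.ne_zero)]

theorem mk_coneMap_mem_imageVariety (W : Submodule K (Ring n K)) (P : Fin (n + 1) → K)
    (hP : coneMap W P ≠ 0) : Projectivization.mk K (coneMap W P) hP ∈ imageVariety W :=
  fun _ _ hp h => (evalDual_rep_mk hp _ hP).2 (h P hP)

theorem evalDual_coneMap (W : Submodule K (Ring n K)) (P : Fin (n + 1) → K)
    (p : MvPolynomial W K) :
    evalDual W (coneMap W P) p = eval P (bind₁ (fun F : W => (F : Ring n K)) p) := by
  have h := aeval_bind₁ P (fun F : W => (F : Ring n K)) p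
  simp only [aeval_eq_eval] at h
  exact h.symm

/-- A homogeneous polynomial that does not vanish identically on the image variety is nonzero at
the image of some point of the torus. -/
theorem exists_torus_point [Infinite K] {W : Submodule K (Ring n K)} {g : MvPolynomial W K} {e : ℕ}
    (hg : g.IsHomogeneous e) {x : Projectivization K (Module.Dual K W)} (hx : x ∈ imageVariety W)
    (hgx : evalDual W x.rep g ≠ 0) :
    ∃ P : Fin (n + 1) → K, (∀ i, P i ≠ 0) ∧ evalDual W (coneMap W P) g ≠ 0 := by
  have h1 : ∃ P : Fin (n + 1) → K, evalDual W (coneMap W P) g ≠ 0 := by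
    by_contra! h
    exact hgx (hx g e hg fun P _ => h P)
  obtain ⟨P, hP⟩ := h1
  rw [evalDual_coneMap] at hP
  set q := bind₁ (fun F : W => (F : Ring n K)) g with hq
  have hq0 : q ≠ 0 := by
    rintro h
    rw [h, map_zero] at hP
    exact hP rfl
  -- The extra factor $\prod_i X_i$ forces a point where the product is nonzero to lie in the torus.
  have hqX : q * ∏ i, X i ≠ 0 :=
    mul_ne_zero hq0 (Finset.prod_ne_zero_iff.2 fun i _ => X_ne_zero i)
  obtain ⟨P, hP⟩ : ∃ P, eval P (q * ∏ i, X i) ≠ 0 := by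
    by_contra! h
    exact hqX (funext fun P => by rw [h P, map_zero])
  rw [map_mul, map_prod] at hP
  simp only [eval_X] at hP
  refine ⟨P, fun i => Finset.prod_ne_zero_iff.1 (right_ne_zero_of_mul hP) i (Finset.mem_univ i), ?_⟩
  rw [evalDual_coneMap]
  exact left_ne_zero_of_mul hP

theorem coneMap_monomial {A : Set (Exponent n)} (P : Fin (n + 1) → K) {a : Exponent n}
    (ha : a ∈ A) :
    coneMap (restrictSupport K A) P (monomialVec A ⟨a, ha⟩) = ∏ i, P i ^ a i := by
  have : coneMap (restrictSupport K A) P (monomialVec A ⟨a, ha⟩) =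
      aeval P (monomial a (1 : K)) := rfl
  rw [this, aeval_eq_eval, eval_monomial,
    Finsupp.prod_fintype _ _ fun i => pow_zero _, one_mul]

/-- The osculating dimension is constant on the torus, and every nonempty open subset of the image
variety contains the image of a torus point, so testing a general point amounts to testing one torus
point. -/
theorem satisfiesLaplace_iff [CharZero K] {A : Set (Exponent n)} {d : ℕ} (hd : d ≠ 0)
    (hA : A ⊆ simplexPoints n d) (hne : A.Nonempty) (s : ℕ) :
    SatisfiesLaplace (restrictSupport K A) s ↔
      ∃ F : Ring n K, IsHypersurface s F ∧ ∀ a ∈ A, ContainsPoint F a := by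
  rw [← finrank_formValues_lt_iff, ← fallingFactorialValues_eq_formValues hd hA]
  have hcone (P : Fin (n + 1) → K) (hP : ∀ i, P i ≠ 0) :
      (∀ a ∈ A, ∏ i, P i ^ a i ≠ 0) ∧ coneMap (restrictSupport K A) P ≠ 0 := by
    have h (a : Exponent n) : ∏ i, P i ^ a i ≠ 0 :=
      Finset.prod_ne_zero_iff.2 fun i _ => pow_ne_zero _ (hP i)
    refine ⟨fun a _ => h a, fun h0 => ?_⟩
    obtain ⟨a, ha⟩ := hne
    apply h a
    rw [← coneMap_monomial P ha, h0, LinearMap.zero_apply]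
  constructor
  · rintro ⟨g, e, hg, ⟨x, hx, hgx⟩, hL⟩
    obtain ⟨P, hP, hgP⟩ := exists_torus_point hg hx hgx
    obtain ⟨hPA, hP0⟩ := hcone P hP
    rw [← finrank_osculatingSpace hPA]
    exact hL _ (mk_coneMap_mem_imageVariety _ P hP0)
      (fun h => hgP ((evalDual_rep_mk hg _ hP0).1 h)) P hP0 rfl
  · intro h
    have := ((finite_simplexPoints n d).subset hA).to_subtype
    have := Fintype.ofFinite A
    -- The product of the coordinates dual to the monomials is nonzero at $\varphi(P)$ exactly when
    -- $P^a\ne0$ for all $a\in A$; the point $(1,\dots,1)$ shows that it does not vanish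
    -- identically.
    set g : MvPolynomial (restrictSupport K A) K := ∏ a : A,
      X (monomialVec A a) with hg
    have hghom : g.IsHomogeneous (∑ _a : A, 1) :=
      IsHomogeneous.prod _ _ _ fun a _ => isHomogeneous_X _ _
    have hgP (P : Fin (n + 1) → K) : evalDual (restrictSupport K A)
        (coneMap (restrictSupport K A) P) g = ∏ a : A, ∏ i, P i ^ (a : Exponent n) i := by
      rw [evalDual, hg, map_prod]
      refine Finset.prod_congr rfl fun a _ => ?_
      rw [eval_X, coneMap_monomial P a.2]
    obtain ⟨h1A, h10⟩ := hcone 1 fun i => one_ne_zero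
    refine ⟨g, _, hghom, ⟨_, mk_coneMap_mem_imageVariety _ 1 h10, ?_⟩, ?_⟩
    · rw [Ne, evalDual_rep_mk hghom, hgP]
      simp
    · rintro _ - hgx P hP rfl
      rw [Ne, evalDual_rep_mk hghom, hgP] at hgx
      rwa [finrank_osculatingSpace fun a ha =>
        Finset.prod_ne_zero_iff.1 hgx ⟨a, ha⟩ (Finset.mem_univ _)]

end GeneralPoint
end Togliatti

namespace Togliatti

/-! ### Artinian monomial ideals. -/

section Artinian

variable {n : ℕ} {K : Type*} [Field K]

/-- If $x_i^d$ is not a generator, every generator involves another variable. Setting the other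
variables to zero then maps the quotient onto $K[x]$, a domain that is not a field and hence not
Artinian. -/
theorem single_mem_of_isArtinianRing {d : ℕ} {G : Set (Exponent n)}
    (hG : G ⊆ simplexPoints n d) (hart : IsArtinianRing (Ring n K ⧸ monomialIdeal K G))
    (i : Fin (n + 1)) : Finsupp.single i d ∈ G := by
  classical
  by_contra hi
  let φ : Ring n K →ₐ[K] Polynomial K :=
    aeval fun j => if j = i then Polynomial.X else 0
  have hφ : ∀ x ∈ monomialIdeal K G, φ x = 0 := by
    intro x hx
    have hle : monomialIdeal K G ≤ RingHom.ker φ := by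
      rw [monomialIdeal, Ideal.span_le]
      rintro _ ⟨m, hm, rfl⟩
      obtain ⟨j, hji, hj⟩ : ∃ j, j ≠ i ∧ m j ≠ 0 := by
        by_contra! h
        have hm' : m = Finsupp.single i (m i) := by
          ext j
          by_cases hj : j = i
          · rw [hj, Finsupp.single_eq_same]
          · rw [Finsupp.single_eq_of_ne hj, h j hj]
        have hd : m.degree = d := hG hm
        rw [hm', Finsupp.degree_single] at hd
        rw [hm', hd] at hm
        exact hi hm
      rw [SetLike.mem_coe, RingHom.mem_ker, aeval_monomial,
        Finsupp.prod_fintype _ _ fun i => pow_zero _]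
      refine mul_eq_zero_of_right _ (Finset.prod_eq_zero (Finset.mem_univ j) ?_)
      rw [if_neg hji, zero_pow hj]
    exact hle hx
  have hsurj : Function.Surjective (Ideal.Quotient.lift (monomialIdeal K G) φ.toRingHom hφ) := by
    refine Ideal.Quotient.lift_surjective_of_surjective _ hφ fun p => ?_
    refine ⟨Polynomial.aeval (X i : Ring n K) p, ?_⟩
    change φ _ = p
    rw [← Polynomial.aeval_algHom_apply]
    simp [φ]
  have := hsurj.isArtinianRing
  exact Polynomial.not_isField K (IsArtinianRing.isField_of_isDomain _)

/-- Each variable is nilpotent in the quotient, which is thus integral and finitely generated over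
$K$, hence finite-dimensional. -/
theorem isArtinianRing_of_single_mem {d : ℕ} {G : Set (Exponent n)}
    (h : ∀ i, Finsupp.single i d ∈ G) : IsArtinianRing (Ring n K ⧸ monomialIdeal K G) := by
  have hX (i : Fin (n + 1)) :
      (Ideal.Quotient.mk (monomialIdeal K G) (X i)) ^ d = 0 := by
    rw [← map_pow, Ideal.Quotient.eq_zero_iff_mem, X_pow_eq_monomial]
    exact Ideal.subset_span ⟨_, h i, rfl⟩
  have hint : Algebra.IsIntegral K (Ring n K ⧸ monomialIdeal K G) := by
    refine ⟨fun y => ?_⟩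
    obtain ⟨f, rfl⟩ := Ideal.Quotient.mk_surjective y
    induction f using MvPolynomial.induction_on with
    | C c => exact isIntegral_algebraMap (x := c)
    | add p q hp hq => rw [map_add]; exact hp.add hq
    | mul_X p i hp =>
      rw [map_mul]
      refine hp.mul ?_
      -- The exponent $d+1$ is positive even if $d=0$.
      refine IsIntegral.of_pow (n := d + 1) d.succ_pos ?_
      rw [pow_succ, hX, zero_mul]
      exact isIntegral_zero
  have : Module.Finite K (Ring n K ⧸ monomialIdeal K G) := Algebra.IsIntegral.finite
  exact IsArtinianRing.of_finite K _

end Artinian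

/-! ### Minimality and the main theorem. -/

section Main

variable {n : ℕ} {K : Type*} [Field K]

theorem IsHypersurface.mul_X_pow {s k : ℕ} {F : Ring n K} (hF : IsHypersurface s F)
    (i : Fin (n + 1)) : IsHypersurface (s + k) (F * X i ^ k) :=
  ⟨mul_ne_zero hF.1 (pow_ne_zero _ (X_ne_zero i)), hF.2.mul (isHomogeneous_X_pow i k)⟩

theorem ContainsPoint.mul_right {F : Ring n K} {a : Exponent n} (h : ContainsPoint F a)
    (H : Ring n K) : ContainsPoint (F * H) a := by
  rw [ContainsPoint] at h ⊢
  rw [map_mul, h, zero_mul]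

/-- By Pascal's rule $\binom{n+d}{n}$ exceeds $\binom{n+d-1}{n-1}$ by $\binom{n+d-1}{n}>0$.
Nonemptiness makes the cone map nonzero on the torus. -/
theorem simplexPoints_diff_nonempty {d : ℕ} (hn : 1 ≤ n) (hd : 1 ≤ d) (G : Finset (Exponent n))
    (hG : G.card ≤ (n + d - 1).choose (n - 1)) : (simplexPoints n d \ G).Nonempty := by
  refine Set.sdiff_nonempty_of_ncard_lt_ncard ?_ G.finite_toSet
  rw [Set.ncard_coe_finset, ncard_simplexPoints]
  refine hG.trans_lt ?_
  obtain ⟨n, rfl⟩ := Nat.exists_eq_add_of_le' hn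
  obtain ⟨d, rfl⟩ := Nat.exists_eq_add_of_le' hd
  rw [← Nat.choose_symm_add, show n + 1 + (d + 1) = (n + d + 1) + 1 by ring,
    show n + d + 1 + 1 - 1 = n + d + 1 by lia, Nat.add_sub_cancel, Nat.choose_succ_succ]
  have : 0 < (n + d + 1).choose (n + 1) := Nat.choose_pos (by lia)
  lia

/-- Artinian ideals generated by few forms are not generated by linear forms. -/
theorem two_le_of_single_mem {d : ℕ} (hn : 1 ≤ n) (hd : 1 ≤ d) {G : Finset (Exponent n)}
    (hG : G.card ≤ (n + d - 1).choose (n - 1)) (h : ∀ i, Finsupp.single i d ∈ G) : 2 ≤ d := by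
  by_contra hd2
  obtain rfl : d = 1 := by lia
  -- For $d=1$ the $n+1$ vertices would have to fit among at most $\binom{n}{n-1}=n$ generators.
  have hcard := Finset.card_le_card_of_injOn (s := Finset.univ) (t := G)
    (fun i : Fin (n + 1) => Finsupp.single i 1) (fun i _ => h i)
    fun i _ j _ hij => Finsupp.single_left_injective one_ne_zero hij
  rw [Finset.card_univ, Fintype.card_fin] at hcard
  obtain ⟨n, rfl⟩ := Nat.exists_eq_add_of_le' hn
  rw [Nat.add_sub_cancel, Nat.add_sub_cancel, Nat.choose_succ_self_right] at hG
  lia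

theorem isMonomialTogliattiSystem_iff [CharZero K] {d : ℕ} (hn : 1 ≤ n) (hd : 1 ≤ d)
    {G : Finset (Exponent n)} (hGd : (G : Set (Exponent n)) ⊆ simplexPoints n d)
    (hG : G.card ≤ (n + d - 1).choose (n - 1)) :
    IsMonomialTogliattiSystem d (monomialIdeal K (G : Set (Exponent n))) ↔
      (∀ i, Finsupp.single i d ∈ G) ∧
      ∃ F : Ring n K, IsHypersurface (d - 1) F ∧
        ∀ a ∈ simplexPoints n d \ G, ContainsPoint F a := by
  classical
  rw [← satisfiesLaplace_iff (by lia) Set.sdiff_subset (simplexPoints_diff_nonempty hn hd G hG),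
    ← inverseSystemDegree_monomialIdeal hGd]
  constructor
  · intro h
    exact ⟨single_mem_of_isArtinianRing hGd h.artinian, h.laplace⟩
  · rintro ⟨h, hL⟩
    refine ⟨⟨isArtinianRing_of_single_mem h, ⟨G.image fun m => monomial m 1, ?_, ?_, ?_⟩, hL⟩,
      _, rfl⟩
    · intro F hF
      obtain ⟨m, hm, rfl⟩ := Finset.mem_image.1 hF
      exact isHomogeneous_monomial _ (hGd hm)
    · exact Finset.card_image_le.trans hG
    · rw [Finset.coe_image]
      rfl

/-- A hypersurface through $A$ and a non-vertex $a\in G$ makes $G\setminus\{a\}$ a Togliatti system.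
Conversely, a hypersurface for a smaller system contains $A$ and every dropped point, and no vertex
can be dropped without losing the Artinian property. -/
theorem isMinimalTogliattiSystem_iff [CharZero K] {d : ℕ} (hn : 1 ≤ n) (hd : 1 ≤ d)
    {G : Finset (Exponent n)} (hGd : (G : Set (Exponent n)) ⊆ simplexPoints n d)
    (hG : G.card ≤ (n + d - 1).choose (n - 1)) (hv : ∀ i, Finsupp.single i d ∈ G) :
    IsMinimalTogliattiSystem d (monomialIdeal K (G : Set (Exponent n))) ↔
      (∃ F : Ring n K, IsHypersurface (d - 1) F ∧
        ∀ a ∈ simplexPoints n d \ G, ContainsPoint F a) ∧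
      ∀ F : Ring n K, IsHypersurface (d - 1) F →
        (∀ a ∈ simplexPoints n d \ G, ContainsPoint F a) →
          ∀ a ∈ G, ContainsPoint F a → a ∈ simplexVertices n d := by
  classical
  constructor
  · intro h
    refine ⟨((isMonomialTogliattiSystem_iff hn hd hGd hG).1 h.toIsMonomialTogliattiSystem).2, ?_⟩
    intro F hF hFA a ha hFa
    by_contra hav
    have hsub : ((G.erase a : Finset (Exponent n)) : Set (Exponent n)) ⊂ G :=
      Finset.coe_ssubset.2 (Finset.erase_ssubset ha)
    refine h.minimal G hGd rfl _ hsub ((isMonomialTogliattiSystem_iff hn hd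
      (hsub.subset.trans hGd) ((Finset.card_erase_le).trans hG)).2 ⟨fun i => ?_, F, hF, ?_⟩)
    · exact Finset.mem_erase.2 ⟨fun h => hav ⟨i, h.symm⟩, hv i⟩
    · rintro b ⟨hbd, hb⟩
      by_cases hba : b = a
      · rwa [hba]
      · exact hFA b ⟨hbd, fun hbG => hb (Finset.mem_coe.2 (Finset.mem_erase.2 ⟨hba, hbG⟩))⟩
  · rintro ⟨hex, hall⟩
    refine ⟨(isMonomialTogliattiSystem_iff hn hd hGd hG).2 ⟨hv, hex⟩, ?_⟩
    intro G₁ hG₁ hG₁I G' hG' hT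
    -- The ideal determines its set of monomial generators of degree $d$.
    obtain rfl := monomialIdeal_injOn hG₁ hGd hG₁I
    obtain ⟨G', rfl⟩ := (G.finite_toSet.subset hG'.subset).exists_finset_coe
    obtain ⟨hv', F, hF, hFA⟩ := (isMonomialTogliattiSystem_iff hn hd (hG'.subset.trans hGd)
      ((Finset.card_le_card (Finset.coe_subset.1 hG'.subset)).trans hG)).1 hT
    obtain ⟨a, ha, ha'⟩ := Set.exists_of_ssubset hG'
    obtain ⟨i, rfl⟩ := hall F hF (fun b hb => hFA b ⟨hb.1, fun h => hb.2 (hG'.subset h)⟩) a ha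
      (hFA a ⟨hGd ha, ha'⟩)
    exact ha' (hv' i)

end Main
end Togliatti

theorem mainTheorem8 {K : Type*} [Field K] [IsAlgClosed K] [CharZero K]
    (n d r : ℕ) (hn : 1 ≤ n) (hd : 1 ≤ d)
    (G : Finset (Togliatti.Exponent n)) (hGd : ∀ m ∈ G, m.degree = d) (hGr : G.card = r)
    (hr : r ≤ (n + d - 1).choose (n - 1))
    (I : Ideal (Togliatti.Ring n K))
    (hI : I = Togliatti.monomialIdeal K (G : Set (Togliatti.Exponent n)))
    (hArt : IsArtinianRing (Togliatti.Ring n K ⧸ I)) :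
    (∀ s ∈ Set.Icc 1 (d - 1),
      Togliatti.SatisfiesLaplace (Togliatti.inverseSystemDegree I d) s ↔
        ∃ F : Togliatti.Ring n K,
          Togliatti.IsHypersurface s F ∧ Togliatti.ContainsLatticeSet F I d) ∧
    (∀ s : ℕ,
      IsLeast {t | t ∈ Set.Icc 1 (d - 1) ∧
          Togliatti.SatisfiesLaplace (Togliatti.inverseSystemDegree I d) t} s ↔
        IsLeast {t | t ∈ Set.Icc 1 (d - 1) ∧ ∃ F : Togliatti.Ring n K,
          Togliatti.IsHypersurface t F ∧ Togliatti.ContainsLatticeSet F I d} s) ∧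
    List.TFAE [
      Togliatti.IsMinimalTogliattiSystem d I,
      (∃ s ∈ Set.Icc 1 (d - 1), ∃ F : Togliatti.Ring n K,
          Togliatti.IsHypersurface s F ∧ Togliatti.ContainsLatticeSet F I d) ∧
        ∀ s ∈ Set.Icc 1 (d - 1), ∀ F : Togliatti.Ring n K,
          Togliatti.IsHypersurface s F → Togliatti.ContainsLatticeSet F I d →
            Togliatti.MeetsComplementOnlyInVertices F I d,
      (∃ F : Togliatti.Ring n K,
          Togliatti.IsHypersurface (d - 1) F ∧ Togliatti.ContainsLatticeSet F I d) ∧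
        ∀ F : Togliatti.Ring n K,
          Togliatti.IsHypersurface (d - 1) F → Togliatti.ContainsLatticeSet F I d →
            Togliatti.MeetsComplementOnlyInVertices F I d] := by
  open Togliatti in
  subst hI hGr
  have hGs : (G : Set (Exponent n)) ⊆ simplexPoints n d := fun m hm => hGd m hm
  have hv := single_mem_of_isArtinianRing hGs hArt
  have hd2 := two_le_of_single_mem hn hd hr hv
  have hne := simplexPoints_diff_nonempty hn hd G hr
  have hlat := latticeSet_monomialIdeal (K := K) hGs
  have ha (s : ℕ) :
      SatisfiesLaplace (inverseSystemDegree (monomialIdeal K (G : Set (Exponent n))) d) s ↔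
      ∃ F : Ring n K, IsHypersurface s F ∧
        ContainsLatticeSet F (monomialIdeal K (G : Set (Exponent n))) d := by
    rw [inverseSystemDegree_monomialIdeal hGs, satisfiesLaplace_iff (by lia) Set.sdiff_subset hne]
    simp only [ContainsLatticeSet, hlat]
  -- Multiplying by a power of $x_0$ reaches degree $d-1$ and keeps every zero of $F$, so a bad
  -- hypersurface of lower degree yields one of degree $d-1$.
  have hmul {s : ℕ} (hs : s ≤ d - 1) {F : Ring n K} (hF : IsHypersurface s F) :
      IsHypersurface (d - 1) (F * X 0 ^ (d - 1 - s)) := by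
    have := hF.mul_X_pow (k := d - 1 - s) 0
    rwa [Nat.add_sub_cancel' hs] at this
  have hmem : d - 1 ∈ Set.Icc 1 (d - 1) := ⟨by lia, le_rfl⟩
  refine ⟨fun s _ => ha s, fun s => by simp only [ha], ?_⟩
  tfae_have 1 ↔ 3 := by
    rw [isMinimalTogliattiSystem_iff hn hd hGs hr hv]
    simp only [ContainsLatticeSet, MeetsComplementOnlyInVertices, hlat, sdiff_sdiff_right_self,
      Set.inf_eq_inter, Set.inter_eq_self_of_subset_right hGs, Finset.mem_coe]
  tfae_have 2 → 3 := by
    rintro ⟨⟨s, hs, F, hF, hFA⟩, hall⟩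
    exact ⟨⟨_, hmul hs.2 hF, fun a ha => (hFA a ha).mul_right _⟩, hall _ hmem⟩
  tfae_have 3 → 2 := by
    rintro ⟨hex, hall⟩
    exact ⟨⟨_, hmem, hex⟩, fun s hs F hF hFA a ha hFa =>
      hall _ (hmul hs.2 hF) (fun b hb => (hFA b hb).mul_right _) a ha (hFa.mul_right _)⟩
  tfae_finish
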